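/- A \emph{parallelogram polyomino} is, up to translation, the (non-empty) set of cells of $\mathbb Z\times\mathbb Z$ enclosed by two lattice paths with North and East unit steps that have the same starting and ending points and intersect only there. A \emph{periodic parallelogram polyomino} (PPP) is a parallelogram polyomino $P$ together with a positive integer $g$ (the gluing size) that is at most the height of the first (leftmost) column and at most the height of the last (rightmost) column of $P$; the rectangles whose gluing size equals the size of their columns are excluded. The $g$ topmost cells of the last column are thought of as glued to the $g$ bottommost cells of the first column. The \emph{width} $w$ of a PPP is its number of columns, its \emph{height} $h$ is the number of rows of $P$ minus $g$, its \emph{semi-perimeter} is $w+h$ and its \emph{area} is its number of cells. A \emph{marked PPP} is a PPP with one marked horizontal edge of its first column at ordinate at least $g$ above the bottom of that column (the edge at the top of the gluing and the top edge of the column are allowed). The columns of a PPP unroll to a sequence of columns indexed by $\mathbb Z$, in which column $i+w$ is column $i$ raised by $h$; a rotation of the PPP consists in reading $w$ consecutive columns of this sequence from another starting column (up to translation, with the same width and height). A \emph{strip} is an equivalence class of PPP's under rotation; semi-perimeter and area are invariant under rotation. Let $n\ge 0$ be an integer. For every $m$ the numbers of PPP's, of marked PPP's and of strips of semi-perimeter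 $n$ and area $m$ are finite; let $A_n(q)$, $B_n(q)$, $C_n(q)$ be the generating functions, according to the area, of PPP's, marked PPP's and strips of semi-perimeter $n$, e.g. $A_n(q)=\sum_{P\in \mathrm{PPP},\ \mathrm{sp}(P)=n} q^{\mathrm{area}(P)}$. Then the coefficients of $A_n(q)$, of $B_n(q)$ and of $C_n(q)$ are ultimately periodic, and in all three cases the (least) period divides $$\operatorname{lcm}\{\, i(n-i) : 1\le i\le n-1 \,\},$$ where the lcm of the empty set is $1$. -/

import Mathlib

namespace PeriodicPolyomino

/-- A unit step of a lattice path. -/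
inductive Step
  | north
  | east
  deriving DecidableEq

/-- The lattice point reached from the origin by a word of steps. -/
def endpoint (p : List Step) : ℕ × ℕ := (p.count Step.east, p.count Step.north)

/-- The lattice points visited by a path that starts at the origin. -/
def vertices (p : List Step) : Set (ℕ × ℕ) := {v | ∃ q : List Step, q <+: p ∧ endpoint q = v}

/-- The ordinates of the successive East steps of a path that starts at the origin. -/
def eastHeights : List Step → List ℕ
  | [] => []
  | Step.north :: p => (eastHeights p).map (· + 1)
  | Step.east :: p => 0 :: eastHeights p

/-- A parallelogram polyomino up to translation (its lower left corner is put at the origin):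
it is given by its upper and its lower boundary, two paths with North and East steps that
intersect only at their starting and ending points. -/
structure ParallelogramPolyomino where
  upper : List Step
  lower : List Step
  upper_head : upper.head? = some Step.north
  lower_head : lower.head? = some Step.east
  endpoint_eq : endpoint upper = endpoint lower
  inter_eq : vertices upper ∩ vertices lower = {(0, 0), endpoint upper}

namespace ParallelogramPolyomino

/-- The number of columns. -/
def width (P : ParallelogramPolyomino) : ℕ := P.upper.count Step.east

/-- The number of rows, before any gluing. -/
def totalHeight (P : ParallelogramPolyomino) : ℕ := P.upper.count Step.north

/-- Ordinate of the bottom of column `i`, for `i < width` (columns are numbered from `0`). -/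
def bottom (P : ParallelogramPolyomino) (i : ℕ) : ℕ := (eastHeights P.lower).getD i 0

/-- Ordinate of the top of column `i`, for `i < width`. -/
def top (P : ParallelogramPolyomino) (i : ℕ) : ℕ := (eastHeights P.upper).getD i 0

/-- The number of cells of column `i`, for `i < width`. -/
def columnHeight (P : ParallelogramPolyomino) (i : ℕ) : ℕ := P.top i - P.bottom i

/-- The cells enclosed by the two paths; a cell is named by its lower left corner. -/
def cells (P : ParallelogramPolyomino) : Finset (Σ _ : ℕ, ℕ) :=
  (Finset.range P.width).sigma fun i => Finset.Ico (P.bottom i) (P.top i)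

/-- The area is the number of cells. -/
def area (P : ParallelogramPolyomino) : ℕ := P.cells.card

/-- All columns span all rows. -/
def IsRectangle (P : ParallelogramPolyomino) : Prop :=
  ∀ i < P.width, P.columnHeight i = P.totalHeight

end ParallelogramPolyomino

/-- A periodic parallelogram polyomino: the `gluing` topmost cells of the last column are
glued to the `gluing` bottommost cells of the first column. Rectangles whose gluing size is the
size of the columns are excluded. -/
structure PPP extends ParallelogramPolyomino where
  gluing : ℕ
  gluing_pos : 0 < gluing
  gluing_le_first : gluing ≤ toParallelogramPolyomino.columnHeight 0
  gluing_le_last :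
    gluing ≤ toParallelogramPolyomino.columnHeight (toParallelogramPolyomino.width - 1)
  nondegenerate :
    ¬ (toParallelogramPolyomino.IsRectangle ∧
      gluing = toParallelogramPolyomino.totalHeight)

namespace PPP

/-- The number of rows, two rows that are glued together being counted once. -/
def height (P : PPP) : ℕ := P.totalHeight - P.gluing

/-- Width plus height. -/
def semiPerimeter (P : PPP) : ℕ := P.width + P.height

/-- Bottom of column `i : ℤ` in the unrolled polyomino, where column
`i + width` is column `i` raised by `height`. -/
def unrolledBottom (P : PPP) (i : ℤ) : ℤ :=
  (P.bottom (i % (P.width : ℤ)).toNat : ℤ) + (i / (P.width : ℤ)) * (P.height : ℤ)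

/-- Top of column `i : ℤ` in the unrolled polyomino. -/
def unrolledTop (P : PPP) (i : ℤ) : ℤ :=
  (P.top (i % (P.width : ℤ)).toNat : ℤ) + (i / (P.width : ℤ)) * (P.height : ℤ)

/-- `Q` is obtained from `P` by a rotation of the cylinder: `Q` is what one gets by starting to
read the columns of `P` on the cylinder at column `k` (and translating vertically). -/
def IsRotation (P Q : PPP) : Prop :=
  Q.width = P.width ∧ Q.height = P.height ∧
    ∃ k c : ℤ, ∀ i : ℤ,
      Q.unrolledBottom i = P.unrolledBottom (i + k) + c ∧
      Q.unrolledTop i = P.unrolledTop (i + k) + c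

theorem isRotation_equivalence : Equivalence IsRotation where
  refl P := ⟨rfl, rfl, 0, 0, fun i => by simp⟩
  symm := by
    rintro P Q ⟨hw, hh, k, c, h⟩
    refine ⟨hw.symm, hh.symm, -k, -c, fun i => ?_⟩
    have := h (i + -k)
    rw [neg_add_cancel_right] at this
    omega
  trans := by
    rintro P Q R ⟨hw, hh, k, c, h⟩ ⟨hw', hh', k', c', h'⟩
    refine ⟨hw'.trans hw, hh'.trans hh, k' + k, c' + c, fun i => ?_⟩
    have h1 := h (i + k')
    have h2 := h' i
    rw [add_assoc] at h1
    omega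

/-- Two PPP's are equivalent when they are in the same orbit under rotation. -/
def rotationSetoid : Setoid PPP := ⟨IsRotation, isRotation_equivalence⟩

theorem sum_range_shift (f : ℤ → ℕ) (w : ℕ) (hf : ∀ i, f (i + w) = f i) (k : ℤ) :
    ∑ i ∈ Finset.range w, f ((i : ℤ) + k) = ∑ i ∈ Finset.range w, f (i : ℤ) := by
  have step : ∀ k : ℤ, ∑ i ∈ Finset.range w, f ((i : ℤ) + (k + 1)) =
      ∑ i ∈ Finset.range w, f ((i : ℤ) + k) := by
    intro k
    have h1 := Finset.sum_range_succ (fun i : ℕ => f ((i : ℤ) + k)) w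
    have h2 := Finset.sum_range_succ' (fun i : ℕ => f ((i : ℤ) + k)) w
    have h3 : f ((w : ℤ) + k) = f k := by rw [add_comm]; exact hf k
    have h4 : ∀ i : ℕ, ((i + 1 : ℕ) : ℤ) + k = (i : ℤ) + (k + 1) := by
      intro i; push_cast; ring
    simp only [h4, Nat.cast_zero, zero_add] at h2
    omega
  induction k using Int.induction_on with
  | zero => simp
  | succ n ih => rw [step, ih]
  | pred n ih => rw [← ih, ← step]; simp

theorem area_eq_sum (P : PPP) : P.area =
    ∑ i ∈ Finset.range P.width, (P.unrolledTop i - P.unrolledBottom i).toNat := by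
  unfold ParallelogramPolyomino.area ParallelogramPolyomino.cells
  rw [Finset.card_sigma]
  refine Finset.sum_congr rfl fun i hi => ?_
  have hi' : (i : ℤ) < P.width := by exact_mod_cast Finset.mem_range.1 hi
  have h0 : (0 : ℤ) ≤ i := Int.natCast_nonneg i
  simp only [unrolledTop, unrolledBottom, Int.emod_eq_of_lt h0 hi', Int.toNat_natCast, Nat.card_Ico]
  omega

theorem area_eq_of_isRotation {P Q : PPP} (h : IsRotation P Q) : P.area = Q.area := by
  obtain ⟨hw, -, k, c, h⟩ := h
  have hQ : ∀ i : ℤ, (Q.unrolledTop i - Q.unrolledBottom i).toNat =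
      (P.unrolledTop (i + k) - P.unrolledBottom (i + k)).toNat := by
    intro i
    have := h i
    congr 1
    omega
  rw [area_eq_sum, area_eq_sum, hw]
  simp only [hQ]
  refine (sum_range_shift (fun i => (P.unrolledTop i - P.unrolledBottom i).toNat) P.width
    (fun i => ?_) k).symm
  by_cases hw0 : P.width = 0
  · simp [hw0]
  · have hw1 : (P.width : ℤ) ≠ 0 := by exact_mod_cast hw0
    simp only [unrolledTop, unrolledBottom, Int.add_emod_right, add_sub_add_right_eq_sub]

end PPP

/-- A marked PPP: a PPP with a marked horizontal edge of its first column, at ordinate `mark`,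
which is above the gluing or at the top of it. -/
structure MarkedPPP extends PPP where
  mark : ℕ
  gluing_le_mark : toPPP.gluing ≤ mark
  mark_le : mark ≤ toPPP.columnHeight 0

/-- A strip is an equivalence class of PPP's under rotation. -/
def Strip : Type := Quotient PPP.rotationSetoid

namespace Strip

/-- The semi-perimeter of any PPP in the class. -/
def semiPerimeter (S : Strip) : ℕ :=
  Quotient.lift PPP.semiPerimeter
    (fun P Q (h : PPP.IsRotation P Q) => by
      obtain ⟨hw, hh, -⟩ := h
      simp only [PPP.semiPerimeter, hw, hh]) S

/-- The area of any PPP in the class. -/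
def area (S : Strip) : ℕ :=
  Quotient.lift (fun P : PPP => P.area)
    (fun _ _ (h : PPP.IsRotation _ _) => PPP.area_eq_of_isRotation h) S

end Strip

/-- The PPP's of semi-perimeter `n` and area `m`. -/
def pppSet (n m : ℕ) : Set PPP := {P | P.semiPerimeter = n ∧ P.area = m}

/-- The marked PPP's of semi-perimeter `n` and area `m`. -/
def markedSet (n m : ℕ) : Set MarkedPPP := {P | P.semiPerimeter = n ∧ P.area = m}

/-- The strips of semi-perimeter `n` and area `m`. -/
def stripSet (n m : ℕ) : Set Strip := {S | S.semiPerimeter = n ∧ S.area = m}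

/-- The area generating function `A_n(q)` of PPP's of semi-perimeter `n`. -/
noncomputable def seriesA (n : ℕ) : PowerSeries ℕ := PowerSeries.mk fun m => (pppSet n m).ncard

/-- The area generating function `B_n(q)` of marked PPP's of semi-perimeter `n`. -/
noncomputable def seriesB (n : ℕ) : PowerSeries ℕ := PowerSeries.mk fun m => (markedSet n m).ncard

/-- The area generating function `C_n(q)` of strips of semi-perimeter `n`. -/
noncomputable def seriesC (n : ℕ) : PowerSeries ℕ := PowerSeries.mk fun m => (stripSet n m).ncard

/-- The positive integer `p` is an ultimate period of the coefficients of `F`. -/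
def IsUltimatePeriod (F : PowerSeries ℕ) (p : ℕ) : Prop :=
  0 < p ∧ ∃ N : ℕ, ∀ m ≥ N, PowerSeries.coeff (m + p) F = PowerSeries.coeff m F

/-- The coefficients of `F` are ultimately periodic, and `p` is their period, that is, the least
of their ultimate periods. -/
def IsPeriod (F : PowerSeries ℕ) (p : ℕ) : Prop := IsLeast {r | IsUltimatePeriod F r} p

/-- The least common multiple of the integers `i (n - i)` for `1 ≤ i ≤ n - 1`. -/
def periodBound (n : ℕ) : ℕ := (Finset.Icc 1 (n - 1)).lcm fun i => i * (n - i)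

end PeriodicPolyomino

open PeriodicPolyomino

namespace PeriodicPolyomino

/-! ### Ultimate periods -/

/-! Adding one cell to every column and one to the gluing ("thickening") keeps the width `w` and the
height, and raises the area by `w`. It is injective, and onto once the area is large compared with
`n`: the gluing is then so large that the first column ends above the place where the last one
begins, and a layer can be peeled off. So, for each width, the number of objects is ultimately
`w`-periodic in the area. Since width and height are both positive, `1 ≤ w ≤ n - 1`, and `w` divides
`w * (n - w)`, hence `periodBound n`. Thickening also shifts marks and commutes with rotation, so
`ncard_add_eq_of_thickening` serves all three families. `ParallelogramPolyomino.exists_thicken_eq`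
carries the surjectivity. -/

theorem exists_isPeriod_dvd {F : PowerSeries ℕ} {L : ℕ} (hL : IsUltimatePeriod F L) :
    ∃ p, IsPeriod F p ∧ p ∣ L := by
  classical
  have hex : ∃ r, IsUltimatePeriod F r := ⟨L, hL⟩
  refine ⟨Nat.find hex, ⟨Nat.find_spec hex, fun r hr => Nat.find_min' hex hr⟩, ?_⟩
  set p := Nat.find hex with hp
  obtain ⟨hp0, N, hN⟩ : IsUltimatePeriod F p := Nat.find_spec hex
  obtain ⟨hL0, M, hM⟩ := hL
  have hmul : ∀ k, ∀ m ≥ N, PowerSeries.coeff (m + p * k) F = PowerSeries.coeff m F := by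
    intro k
    induction k with
    | zero => simp
    | succ k ih =>
      intro m hm
      rw [Nat.mul_succ, ← add_assoc, hN _ (by omega), ih m hm]
  by_contra hdvd
  have hr : 0 < L % p := Nat.pos_of_ne_zero fun h => hdvd (Nat.dvd_of_mod_eq_zero h)
  -- The remainder `L % p` would be a smaller ultimate period: adding `p * (L / p)` to it gives a
  -- shift by `L`.
  refine Nat.find_min hex (Nat.mod_lt L hp0) ⟨hr, N + M, fun m hm => ?_⟩
  rw [← hmul (L / p) (m + L % p) (by omega), add_assoc, Nat.mod_add_div, hM m (by omega)]

theorem periodBound_pos (n : ℕ) : 0 < periodBound n := by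
  refine Nat.pos_of_ne_zero fun h => ?_
  obtain ⟨i, hi, h0⟩ := Finset.lcm_eq_zero_iff.1 h
  have := Finset.mem_Icc.1 hi
  rcases Nat.mul_eq_zero.1 h0 with h | h <;> omega

theorem dvd_periodBound {n i : ℕ} (h0 : 0 < i) (hi : i < n) : i ∣ periodBound n :=
  (Nat.dvd_mul_right i (n - i)).trans
    (Finset.dvd_lcm (f := fun i => i * (n - i)) (Finset.mem_Icc.2 ⟨h0, by omega⟩))

/-- If an injective map preserves the size and the width, adds the width to the area, and is onto
in large area, then the numbers of objects of a given size are ultimately periodic. -/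
theorem ncard_add_eq_of_thickening {X : Type*} (size area width : X → ℕ) (f : X → X)
    (hf : Function.Injective f) (hsize : ∀ x, size (f x) = size x)
    (hwidth : ∀ x, width (f x) = width x) (harea : ∀ x, area (f x) = area x + width x)
    {n L N : ℕ} (hL : ∀ x, size x = n → width x ∣ L)
    (hsurj : ∀ x, size x = n → N ≤ area x → ∃ y, f y = x) {m : ℕ} (hm : N ≤ m) :
    {x | size x = n ∧ area x = m + L}.ncard = {x | size x = n ∧ area x = m}.ncard := by
  have hsize' : ∀ k x, size (f^[k] x) = size x := fun k x => by
    induction k with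
    | zero => rfl
    | succ k ih => rw [Function.iterate_succ_apply', hsize, ih]
  have hwidth' : ∀ k x, width (f^[k] x) = width x := fun k x => by
    induction k with
    | zero => rfl
    | succ k ih => rw [Function.iterate_succ_apply', hwidth, ih]
  have harea' : ∀ k x, area (f^[k] x) = area x + k * width x := fun k x => by
    induction k with
    | zero => simp
    | succ k ih => rw [Function.iterate_succ_apply', harea, ih, hwidth', Nat.succ_mul, add_assoc]
  -- Each preimage costs one width of area, and the area must still be at least `N` before each
  -- peeling.
  have hsurj' : ∀ k x, size x = n → N + k * width x ≤ area x → ∃ y, f^[k] y = x := by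
    intro k
    induction k with
    | zero => exact fun x _ _ => ⟨x, rfl⟩
    | succ k ih =>
      intro x hx hN
      rw [Nat.succ_mul] at hN
      obtain ⟨y, rfl⟩ := hsurj x hx (by omega)
      rw [hwidth, harea] at hN
      rw [hsize] at hx
      obtain ⟨z, rfl⟩ := ih y hx (by omega)
      exact ⟨z, Function.iterate_succ_apply' f k z⟩
  -- The number of iterations depends on the object, so that each one gains exactly `L`. It is
  -- constant on each width class, which thickening preserves; hence injectivity below.
  have himage : {x | size x = n ∧ area x = m + L} =
      (fun x => f^[L / width x] x) '' {x | size x = n ∧ area x = m} := by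
    ext x
    constructor
    · rintro ⟨hx, hxa⟩
      have hdiv := Nat.div_mul_cancel (hL x hx)
      obtain ⟨y, hy⟩ := hsurj' (L / width x) x hx (by omega)
      have hw : width y = width x := by rw [← hy, hwidth']
      rw [← hy, hsize'] at hx
      have ha := harea' (L / width x) y
      rw [hy, hw, hdiv] at ha
      exact ⟨y, ⟨hx, by omega⟩, by simpa only [hw] using hy⟩
    · rintro ⟨y, ⟨hy, hya⟩, rfl⟩
      refine ⟨(hsize' _ y).trans hy, ?_⟩
      simp only [harea', hya, Nat.div_mul_cancel (hL y hy)]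
  rw [himage, Set.ncard_image_of_injective]
  intro x y hxy
  have hw : width x = width y := by
    have := congrArg width hxy
    simpa only [hwidth'] using this
  simp only [hw] at hxy
  exact hf.iterate _ hxy

/-! ### Words of steps -/

instance : Finite Step :=
  Finite.of_injective (fun s : Step => decide (s = Step.north)) fun s t h => by
    cases s <;> cases t <;> simp_all

theorem count_north_add_count_east (p : List Step) :
    p.count Step.north + p.count Step.east = p.length := by
  induction p with
  | nil => rfl
  | cons s p ih => cases s <;> simp <;> omega

theorem length_eastHeights (p : List Step) : (eastHeights p).length = p.count Step.east := by
  induction p with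
  | nil => rfl
  | cons s p ih => cases s <;> simp [eastHeights, ih]

theorem eastHeights_append_north (p : List Step) :
    eastHeights (p ++ [Step.north]) = eastHeights p := by
  induction p with
  | nil => rfl
  | cons s p ih => cases s <;> simp [eastHeights, ih]

theorem getD_map_add_one {l : List ℕ} {i : ℕ} (hi : i < l.length) :
    (l.map (· + 1)).getD i 0 = l.getD i 0 + 1 := by
  simp [List.getD_eq_getElem?_getD, hi]

theorem getD_eastHeights_le (p : List Step) (i : ℕ) :
    (eastHeights p).getD i 0 ≤ p.count Step.north := by
  by_cases hi : i < (eastHeights p).length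
  · induction p generalizing i with
    | nil => simp [eastHeights]
    | cons s p ih =>
      cases s with
      | north =>
        have hi' : i < (eastHeights p).length := by simpa [eastHeights] using hi
        rw [eastHeights, getD_map_add_one hi']
        simpa using ih i hi'
      | east =>
        cases i with
        | zero => simp [eastHeights]
        | succ i => simpa [eastHeights] using ih i (by simpa [eastHeights] using hi)
  · simp [List.getD_eq_getElem?_getD, List.getElem?_eq_none (not_lt.1 hi)]

theorem pairwise_eastHeights (p : List Step) : (eastHeights p).Pairwise (· ≤ ·) := by
  induction p with
  | nil => simp [eastHeights]
  | cons s p ih => cases s <;> simp [eastHeights, List.pairwise_map, ih]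

theorem getD_eastHeights_mono (p : List Step) {i j : ℕ} (hij : i ≤ j)
    (hj : j < p.count Step.east) : (eastHeights p).getD i 0 ≤ (eastHeights p).getD j 0 := by
  rw [← length_eastHeights] at hj
  rcases hij.eq_or_lt with rfl | hlt
  · rfl
  · rw [List.getD_eq_getElem _ _ (hlt.trans hj), List.getD_eq_getElem _ _ hj]
    exact List.pairwise_iff_getElem.1 (pairwise_eastHeights p) i j _ _ hlt

/-- The East step number `i` stands at position `i + eastHeights p i` in the word `p`. -/
theorem count_take_le_iff (p : List Step) {i : ℕ} (hi : i < p.count Step.east) (k : ℕ) :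
    (p.take k).count Step.east ≤ i ↔ k ≤ i + (eastHeights p).getD i 0 := by
  induction p generalizing i k with
  | nil => simp at hi
  | cons s p ih =>
    cases k with
    | zero => simp
    | succ k =>
      cases s with
      | north =>
        have hi' : i < p.count Step.east := by simpa using hi
        rw [eastHeights, getD_map_add_one (by rwa [length_eastHeights])]
        have := ih hi' k
        rw [List.take_succ_cons, List.count_cons_of_ne (by decide)]
        omega
      | east =>
        cases i with
        | zero => simp [eastHeights]
        | succ i =>
          have := ih (i := i) (by simpa using hi) k
          simp [eastHeights] at this ⊢
          omega

theorem count_take_mono (p : List Step) {j k : ℕ} (h : j ≤ k) :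
    (p.take j).count Step.east ≤ (p.take k).count Step.east :=
  ((List.take_prefix_take_left h).sublist).count_le _

theorem count_take_succ_le (p : List Step) (k : ℕ) :
    (p.take (k + 1)).count Step.east ≤ (p.take k).count Step.east + 1 := by
  rw [List.take_add_one, List.count_append]
  have : (p[k]?.toList).count Step.east ≤ (p[k]?.toList).length := List.count_le_length
  have : (p[k]?.toList).length ≤ 1 := by cases p[k]? <;> simp
  omega

/-- A lattice point determines the number of steps leading to it, so two paths can only meet at
equal times; only East counts remain to be compared. -/
theorem endpoint_eq_iff {p q : List Step} :
    endpoint p = endpoint q ↔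
      p.length = q.length ∧ p.count Step.east = q.count Step.east := by
  have := count_north_add_count_east p
  have := count_north_add_count_east q
  simp only [endpoint, Prod.mk.injEq]
  omega

/-- Two paths that meet only at their ends, the second one starting below the first one: in
between, the second path is strictly to the right of the first one. -/
theorem inter_vertices_eq_iff {u l : List Step} (hu : u.head? = some Step.north)
    (hl : l.head? = some Step.east) (h : endpoint u = endpoint l) :
    vertices u ∩ vertices l = {(0, 0), endpoint u} ↔
      ∀ k, 0 < k → k < u.length →
        (u.take k).count Step.east < (l.take k).count Step.east := by
  obtain ⟨hlen, hcount⟩ := endpoint_eq_iff.1 h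
  constructor
  · intro hint k hk0 hk
    induction k with
    | zero => omega
    | succ k ih =>
      rcases Nat.eq_zero_or_pos k with rfl | hk1
      · obtain ⟨a, u, rfl⟩ : ∃ a u', u = a :: u' := List.exists_cons_of_ne_nil (by rintro rfl; simp at hu)
        obtain ⟨b, l, rfl⟩ : ∃ a l', l = a :: l' := List.exists_cons_of_ne_nil (by rintro rfl; simp at hl)
        simp at hu hl
        simp [hu, hl]
      · have h1 := ih hk1 (by omega)
        have h2 := count_take_succ_le u k
        have h3 := count_take_mono l (show k ≤ k + 1 by omega)
        -- In one step the upper path gains at most one East step and the lower path loses none, so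
        -- strictness can only fail through equality, that is, an inner common vertex.
        refine lt_of_le_of_ne (by omega) fun heq => ?_
        have hlen1 : (u.take (k + 1)).length = k + 1 := by simp; omega
        have hlen2 : (l.take (k + 1)).length = k + 1 := by simp; omega
        have hmem : endpoint (u.take (k + 1)) ∈ vertices u ∩ vertices l :=
          ⟨⟨_, List.take_prefix _ _, rfl⟩, ⟨_, List.take_prefix _ _,
            endpoint_eq_iff.2 ⟨by omega, heq.symm⟩⟩⟩
        rw [hint] at hmem
        rcases hmem with hmem | hmem
        · have := (endpoint_eq_iff (q := [])).1 hmem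
          simp only [List.length_nil] at this
          omega
        · have := endpoint_eq_iff.1 hmem
          omega
  · intro hlt
    ext v
    constructor
    · rintro ⟨⟨p, hp, rfl⟩, ⟨q, hq, hpq⟩⟩
      obtain ⟨h1, h2⟩ := endpoint_eq_iff.1 hpq
      have hple := hp.length_le
      rw [List.prefix_iff_eq_take] at hp hq
      by_cases h0 : p.length = 0
      · left; rw [List.length_eq_zero_iff.1 h0]; rfl
      · rcases hple.eq_or_lt with h3 | h3
        · right
          rw [h3, List.take_length] at hp
          rw [hp]; rfl
        · have := hlt p.length (by omega) h3
          rw [← hp, ← h1, ← hq] at this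
          omega
    · rintro (rfl | rfl)
      · exact ⟨⟨[], List.nil_prefix, rfl⟩, ⟨[], List.nil_prefix, rfl⟩⟩
      · exact ⟨⟨u, List.prefix_refl u, rfl⟩, ⟨l, List.prefix_refl l, h.symm⟩⟩

namespace ParallelogramPolyomino

/-! ### Columns of a parallelogram polyomino -/

variable (P : ParallelogramPolyomino)

@[ext]
theorem ext {P Q : ParallelogramPolyomino} (hu : P.upper = Q.upper) (hl : P.lower = Q.lower) :
    P = Q := by
  cases P; cases Q; simp_all

theorem length_eq : P.upper.length = P.lower.length := (endpoint_eq_iff.1 P.endpoint_eq).1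

theorem count_east_lower : P.lower.count Step.east = P.width :=
  (endpoint_eq_iff.1 P.endpoint_eq).2.symm

theorem totalHeight_add_width : P.totalHeight + P.width = P.upper.length :=
  count_north_add_count_east _

theorem width_pos : 0 < P.width := by
  rw [← P.count_east_lower]
  exact List.count_pos_iff.2 (List.mem_of_mem_head? P.lower_head)

theorem count_take_lt {k : ℕ} (h0 : 0 < k) (hk : k < P.upper.length) :
    (P.upper.take k).count Step.east < (P.lower.take k).count Step.east :=
  (inter_vertices_eq_iff P.upper_head P.lower_head P.endpoint_eq).1 P.inter_eq k h0 hk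

theorem count_take_le (k : ℕ) :
    (P.upper.take k).count Step.east ≤ (P.lower.take k).count Step.east := by
  rcases Nat.eq_zero_or_pos k with rfl | h0
  · simp
  · rcases lt_or_ge k P.upper.length with hk | hk
    · exact (P.count_take_lt h0 hk).le
    · rw [List.take_of_length_le hk, List.take_of_length_le (P.length_eq ▸ hk)]
      exact P.count_east_lower.ge

theorem bottom_le_top {i : ℕ} (hi : i < P.width) : P.bottom i ≤ P.top i := by
  -- At time `i + top i + 1` the upper path has made East step `i` but the lower one has not.
  by_contra hlt
  have h1 := count_take_le_iff P.upper hi (i + P.top i + 1)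
  have h2 := count_take_le_iff P.lower (P.count_east_lower ▸ hi) (i + P.top i + 1)
  have := P.count_take_le (i + P.top i + 1)
  unfold bottom top at *
  omega

theorem top_le (i : ℕ) : P.top i ≤ P.totalHeight := getD_eastHeights_le _ _

theorem columnHeight_le (i : ℕ) : P.columnHeight i ≤ P.totalHeight :=
  (Nat.sub_le _ _).trans (P.top_le i)

theorem area_eq_sum_columnHeight : P.area = ∑ i ∈ Finset.range P.width, P.columnHeight i := by
  simp [area, cells, columnHeight]

theorem area_le : P.area ≤ P.width * P.totalHeight := by
  rw [area_eq_sum_columnHeight]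
  simpa using Finset.sum_le_card_nsmul (Finset.range P.width) P.columnHeight P.totalHeight
    fun i _ => P.columnHeight_le i

theorem columnHeight_zero_le_area : P.columnHeight 0 ≤ P.area := by
  rw [area_eq_sum_columnHeight]
  exact Finset.single_le_sum (f := P.columnHeight) (fun _ _ => Nat.zero_le _)
    (Finset.mem_range.2 P.width_pos)

/-! ### Adding a cell to every column -/

/-- Raise the upper boundary by one unit. -/
def thicken : ParallelogramPolyomino where
  upper := Step.north :: P.upper
  lower := P.lower ++ [Step.north]
  upper_head := rfl
  lower_head := by rw [List.head?_append, P.lower_head]; rfl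
  endpoint_eq := by
    rw [endpoint_eq_iff]
    simpa [width] using ⟨P.length_eq, P.count_east_lower.symm⟩
  inter_eq := by
    rw [inter_vertices_eq_iff rfl (by rw [List.head?_append, P.lower_head]; rfl)]
    · intro k h0 hk
      obtain ⟨k, rfl⟩ := Nat.exists_eq_succ_of_ne_zero h0.ne'
      have hk' : k < P.upper.length := by simpa using hk
      rw [List.take_append_of_le_length (by have := P.length_eq; omega)]
      simp only [List.take_succ_cons]
      rw [List.count_cons_of_ne (by decide)]
      rcases Nat.eq_zero_or_pos k with rfl | hk0
      · simp only [List.take_zero, List.count_nil]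
        refine List.count_pos_iff.2 (List.mem_of_mem_head? ?_)
        rw [List.head?_take, P.lower_head]
        rfl
      -- The new upper path is the old one delayed by one step, which only widens the gap.
      · exact (P.count_take_lt hk0 hk').trans_le (count_take_mono _ (Nat.le_succ k))
    · rw [endpoint_eq_iff]
      simpa [width] using ⟨P.length_eq, P.count_east_lower.symm⟩

@[simp] theorem width_thicken : P.thicken.width = P.width := by simp [thicken, width]

@[simp] theorem totalHeight_thicken : P.thicken.totalHeight = P.totalHeight + 1 := by
  simp [thicken, totalHeight]

theorem bottom_thicken (i : ℕ) : P.thicken.bottom i = P.bottom i := by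
  simp [thicken, bottom, eastHeights_append_north]

/-- The bound on `i` matters: beyond the width both tops are the default value `0`. -/
theorem top_thicken {i : ℕ} (hi : i < P.width) : P.thicken.top i = P.top i + 1 :=
  getD_map_add_one ((length_eastHeights P.upper).symm ▸ hi)

theorem columnHeight_thicken {i : ℕ} (hi : i < P.width) :
    P.thicken.columnHeight i = P.columnHeight i + 1 := by
  have := P.bottom_le_top hi
  rw [columnHeight, columnHeight, bottom_thicken, top_thicken P hi]
  omega

theorem area_thicken : P.thicken.area = P.area + P.width := by
  rw [area_eq_sum_columnHeight, area_eq_sum_columnHeight, width_thicken,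
    Finset.sum_congr rfl fun i hi => P.columnHeight_thicken (Finset.mem_range.1 hi)]
  simp [Finset.sum_add_distrib]

theorem isRectangle_thicken : P.thicken.IsRectangle ↔ P.IsRectangle := by
  unfold IsRectangle
  rw [width_thicken, totalHeight_thicken]
  refine forall₂_congr fun i hi => ?_
  rw [P.columnHeight_thicken hi, Nat.add_right_cancel_iff]

theorem thicken_injective : Function.Injective thicken := by
  intro P Q h
  refine ParallelogramPolyomino.ext ?_ ?_
  · exact (List.cons.inj (congrArg upper h)).2
  · exact List.append_cancel_right (congrArg lower h)

/-- A polyomino is obtained by thickening when its first column ends above the beginning of its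
last column, with some margin. -/
theorem exists_thicken_eq (htop : 2 ≤ P.top 0)
    (h : P.width + P.bottom (P.width - 1) ≤ P.top 0) : ∃ Q : ParallelogramPolyomino, Q.thicken = P := by
  have hw := P.width_pos
  have hlen := P.length_eq
  have hsum := P.totalHeight_add_width
  have htopT := P.top_le 0
  have hupper : ∀ k ≤ P.top 0, (P.upper.take k).count Step.east = 0 := by
    intro k hk
    exact Nat.le_zero.1 ((count_take_le_iff P.upper hw k).2 (by unfold top at hk; omega))
  -- The last East step of the lower path ends at time `width + bottom (width - 1)`.
  have hlower : ∀ k, P.top 0 ≤ k → (P.lower.take k).count Step.east = P.width := by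
    intro k hk
    have h1 := count_take_le_iff P.lower (i := P.width - 1) (by rw [P.count_east_lower]; omega) k
    have h2 := ((List.take_prefix k P.lower).sublist).count_le Step.east
    rw [P.count_east_lower] at h2
    unfold bottom at h
    omega
  obtain ⟨u, hu⟩ : ∃ u, P.upper = Step.north :: u := by
    have := P.upper_head
    cases hU : P.upper with
    | nil => simp [hU] at this
    | cons a u => rw [hU] at this; simp at this; exact ⟨u, by rw [this]⟩
  obtain ⟨l, b, hl⟩ : ∃ l b, P.lower = l ++ [b] := by
    rcases List.eq_nil_or_concat P.lower with h | ⟨l, b, h⟩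
    · have := P.lower_head; simp [h] at this
    · exact ⟨l, b, by simpa using h⟩
  have hlenu : P.upper.length = u.length + 1 := by rw [hu]; rfl
  have hlenl : P.lower.length = l.length + 1 := by rw [hl]; simp
  have hcl : l.count Step.east = P.width := by
    have := hlower l.length (by omega)
    rwa [hl, List.take_left'  rfl] at this
  have hb : b = Step.north := by
    cases b with
    | north => rfl
    | east =>
      have := P.count_east_lower
      rw [hl] at this
      simp at this
      omega
  subst hb
  have hcu : u.count Step.east = P.width := by
    rw [width, hu]; simp
  have huh : u.head? = some Step.north := by
    have h2 := hupper 2 htop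
    cases u with
    | nil => simp at hlenu; omega
    | cons a u =>
      cases a with
      | north => rfl
      | east => rw [hu] at h2; simp at h2
  have hlh : l.head? = some Step.east := by
    have := P.lower_head
    cases l with
    | nil => simp at hcl; omega
    | cons a l => rw [hl] at this; simpa using this
  have hend : endpoint u = endpoint l := endpoint_eq_iff.2 ⟨by omega, by rw [hcu, hcl]⟩
  refine ⟨⟨u, l, huh, hlh, hend, (inter_vertices_eq_iff huh hlh hend).2 fun k h0 hk => ?_⟩,
    ParallelogramPolyomino.ext hu.symm hl.symm⟩
  have e1 : (u.take k).count Step.east = (P.upper.take (k + 1)).count Step.east := by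
    rw [hu]; simp
  have e2 : (l.take k).count Step.east = (P.lower.take k).count Step.east := by
    rw [hl, List.take_append_of_le_length (by omega)]
  rw [e1, e2]
  -- The upper path must be compared at time `k + 1` with the lower one at time `k`. Before `top 0`
  -- the upper count is stationary at `0`; from `top 0` on the lower count is stationary at the
  -- width. Either way both can be read at the same time.
  rcases Nat.lt_or_ge k (P.top 0) with hk1 | hk1
  · rw [hupper (k + 1) hk1, ← hupper k hk1.le]
    exact P.count_take_lt h0 (by omega)
  · rw [hlower k hk1, ← hlower (k + 1) (by omega)]
    exact P.count_take_lt (Nat.succ_pos k) (by omega)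

end ParallelogramPolyomino

namespace PPP

/-! ### Periodic parallelogram polyominoes -/

variable (P : PPP)

@[ext]
theorem ext {P Q : PPP} (h : P.toParallelogramPolyomino = Q.toParallelogramPolyomino)
    (hg : P.gluing = Q.gluing) : P = Q := by
  cases P; cases Q; simp_all

theorem gluing_le_totalHeight : P.gluing ≤ P.totalHeight :=
  P.gluing_le_first.trans (P.columnHeight_le 0)

theorem height_add_gluing : P.height + P.gluing = P.totalHeight :=
  Nat.sub_add_cancel P.gluing_le_totalHeight

theorem gluing_le_area : P.gluing ≤ P.area :=
  P.gluing_le_first.trans P.columnHeight_zero_le_area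

theorem bottom_last_le : P.bottom (P.width - 1) ≤ P.height := by
  have h1 := P.gluing_le_last
  have h2 := P.gluing_pos
  have h3 := P.top_le (P.width - 1)
  have h4 := P.height_add_gluing
  unfold ParallelogramPolyomino.columnHeight at h1
  omega

/-- With height `0` the first column reaches the top and the last one the bottom; by monotonicity
every column is full, which is the excluded rectangle. -/
theorem height_pos : 0 < P.height := by
  refine Nat.pos_of_ne_zero fun h0 => P.nondegenerate ?_
  have hT := P.height_add_gluing
  rw [h0, zero_add] at hT
  refine ⟨fun i hi => ?_, hT⟩
  have h1 := P.gluing_le_first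
  have h2 := P.bottom_last_le
  have h3 : P.top 0 ≤ P.top i := getD_eastHeights_mono _ (Nat.zero_le i) hi
  have h4 : P.bottom i ≤ P.bottom (P.width - 1) :=
    getD_eastHeights_mono _ (by omega) (by rw [P.count_east_lower]; omega)
  have h5 := P.top_le i
  unfold ParallelogramPolyomino.columnHeight at *
  omega

/-- Add a cell to every column of a PPP, and to the gluing. -/
def thicken : PPP where
  toParallelogramPolyomino := P.toParallelogramPolyomino.thicken
  gluing := P.gluing + 1
  gluing_pos := Nat.succ_pos _
  gluing_le_first := by
    rw [ParallelogramPolyomino.columnHeight_thicken _ P.width_pos]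
    exact Nat.succ_le_succ P.gluing_le_first
  gluing_le_last := by
    rw [ParallelogramPolyomino.width_thicken,
      ParallelogramPolyomino.columnHeight_thicken _ (Nat.sub_lt P.width_pos Nat.one_pos)]
    exact Nat.succ_le_succ P.gluing_le_last
  nondegenerate := by
    rw [ParallelogramPolyomino.isRectangle_thicken, ParallelogramPolyomino.totalHeight_thicken,
      Nat.add_right_cancel_iff]
    exact P.nondegenerate

@[simp] theorem width_thicken : P.thicken.width = P.width :=
  P.toParallelogramPolyomino.width_thicken

@[simp] theorem height_thicken : P.thicken.height = P.height := by
  have h1 := P.thicken.height_add_gluing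
  have h2 := P.height_add_gluing
  have h3 : P.thicken.totalHeight = P.totalHeight + 1 :=
    P.toParallelogramPolyomino.totalHeight_thicken
  have h4 : P.thicken.gluing = P.gluing + 1 := rfl
  omega

@[simp] theorem semiPerimeter_thicken : P.thicken.semiPerimeter = P.semiPerimeter := by
  simp [semiPerimeter]

theorem area_thicken : P.thicken.area = P.area + P.width :=
  P.toParallelogramPolyomino.area_thicken

theorem thicken_injective : Function.Injective thicken := fun _ _ h =>
  PPP.ext (ParallelogramPolyomino.thicken_injective (congrArg toParallelogramPolyomino h))
    (Nat.succ_injective (congrArg gluing h))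

theorem width_dvd_periodBound {n : ℕ} (h : P.semiPerimeter = n) : P.width ∣ periodBound n :=
  dvd_periodBound P.width_pos (by have := P.height_pos; unfold semiPerimeter at h; omega)

/-- The area is at most `n * (height + gluing)`, so `height + gluing ≥ 2 * n + 2`, while `height ≤
n`. -/
theorem lt_gluing_of_le_area {n : ℕ} (hn : P.semiPerimeter = n)
    (ha : n * (2 * n + 2) ≤ P.area) : n + 2 ≤ P.gluing := by
  have h1 := P.area_le
  have h2 := P.width_pos
  have h3 := P.height_add_gluing
  have h4 : P.width ≤ n := by unfold semiPerimeter at hn; omega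
  have h5 : n * (2 * n + 2) ≤ n * P.totalHeight :=
    ha.trans (h1.trans (Nat.mul_le_mul_right _ h4))
  have h6 := Nat.le_of_mul_le_mul_left h5 (by omega)
  unfold semiPerimeter at hn
  omega

/-- The top of the first column is at least `gluing ≥ n + 2`, whereas the width plus the bottom of
the last column is at most width plus height, which is `n`. -/
theorem exists_thicken_eq {n : ℕ} (hn : P.semiPerimeter = n)
    (ha : n * (2 * n + 2) ≤ P.area) : ∃ Q : PPP, Q.thicken = P := by
  have hg := P.lt_gluing_of_le_area hn ha
  have hfirst := P.gluing_le_first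
  have hlast := P.gluing_le_last
  have hnondeg := P.nondegenerate
  have hb := P.bottom_last_le
  have htop : P.gluing ≤ P.top 0 := hfirst.trans (Nat.sub_le _ _)
  obtain ⟨Q, hQ⟩ := P.toParallelogramPolyomino.exists_thicken_eq (by omega)
    (by unfold semiPerimeter at hn; omega)
  rw [← hQ, Q.columnHeight_thicken Q.width_pos] at hfirst
  rw [← hQ, Q.width_thicken,
    Q.columnHeight_thicken (Nat.sub_lt Q.width_pos Nat.one_pos)] at hlast
  rw [← hQ, Q.isRectangle_thicken, Q.totalHeight_thicken] at hnondeg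
  exact ⟨⟨Q, P.gluing - 1, by omega, by omega, by omega, fun h => hnondeg ⟨h.1, by omega⟩⟩,
    PPP.ext hQ (by simp only [thicken]; omega)⟩

theorem finite_pppSet (n m : ℕ) : (pppSet n m).Finite := by
  -- Both words have length `n + gluing`, and the gluing is at most the area `m`.
  have hfin := List.finite_length_le Step (2 * n + m)
  refine Set.Finite.of_finite_image (f := fun P : PPP => (P.upper, P.lower, P.gluing))
    ((hfin.prod (hfin.prod (Set.finite_Iic m))).subset ?_) ?_
  · rintro _ ⟨P, ⟨hn, hm⟩, rfl⟩
    have h1 := P.totalHeight_add_width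
    have h2 := P.length_eq
    have h3 := P.height_add_gluing
    have h4 := P.gluing_le_area
    unfold semiPerimeter at hn
    refine ⟨?_, ?_, ?_⟩
    · show P.upper.length ≤ _; omega
    · show P.lower.length ≤ _; omega
    · show P.gluing ≤ m; omega
  · intro P _ Q _ h
    simp only [Prod.mk.injEq] at h
    exact PPP.ext (ParallelogramPolyomino.ext h.1 h.2.1) h.2.2

theorem unrolledBottom_thicken (i : ℤ) : P.thicken.unrolledBottom i = P.unrolledBottom i := by
  unfold unrolledBottom
  rw [width_thicken, height_thicken]
  exact congrArg (fun a : ℕ => (a : ℤ) + _)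
    (P.toParallelogramPolyomino.bottom_thicken _)

theorem unrolledTop_thicken (i : ℤ) : P.thicken.unrolledTop i = P.unrolledTop i + 1 := by
  have hw : (0 : ℤ) < P.width := by exact_mod_cast P.width_pos
  have h1 := Int.emod_nonneg i hw.ne'
  have h2 := Int.emod_lt_of_pos i hw
  have h3 : P.thicken.top (i % (P.width : ℤ)).toNat = P.top (i % (P.width : ℤ)).toNat + 1 :=
    P.toParallelogramPolyomino.top_thicken (by omega)
  unfold unrolledTop
  rw [width_thicken, height_thicken, h3]
  push_cast
  ring

/-- All unrolled tops rise by one and the bottoms stay, so the same shifts `k` and `c` work in both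
directions. One direction lets thickening descend to strips, the other makes it injective there. -/
theorem isRotation_thicken {P Q : PPP} : IsRotation P.thicken Q.thicken ↔ IsRotation P Q := by
  unfold IsRotation
  simp only [width_thicken, height_thicken, unrolledBottom_thicken, unrolledTop_thicken,
    add_right_comm _ (1 : ℤ), add_left_inj]

end PPP

namespace MarkedPPP

/-! ### Marked periodic parallelogram polyominoes -/

variable (P : MarkedPPP)

@[ext]
theorem ext {P Q : MarkedPPP} (h : P.toPPP = Q.toPPP) (hm : P.mark = Q.mark) : P = Q := by
  cases P; cases Q; simp_all

/-- Add a cell to every column of a marked PPP, and to the gluing, and raise the mark. -/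
def thicken : MarkedPPP where
  toPPP := P.toPPP.thicken
  mark := P.mark + 1
  gluing_le_mark := Nat.succ_le_succ P.gluing_le_mark
  mark_le := by
    have := ParallelogramPolyomino.columnHeight_thicken _ P.width_pos
    exact (Nat.succ_le_succ P.mark_le).trans this.ge

theorem thicken_injective : Function.Injective thicken := fun _ _ h =>
  MarkedPPP.ext (PPP.thicken_injective (congrArg toPPP h)) (Nat.succ_injective (congrArg mark h))

theorem exists_thicken_eq {n : ℕ} (hn : P.semiPerimeter = n)
    (ha : n * (2 * n + 2) ≤ P.area) : ∃ Q : MarkedPPP, Q.thicken = P := by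
  obtain ⟨Q, hQ⟩ := P.toPPP.exists_thicken_eq hn ha
  have h1 := P.gluing_le_mark
  have h2 := P.mark_le
  rw [← hQ] at h1 h2
  have h3 : Q.thicken.columnHeight 0 = Q.columnHeight 0 + 1 :=
    ParallelogramPolyomino.columnHeight_thicken _ Q.width_pos
  have h4 : Q.thicken.gluing = Q.gluing + 1 := rfl
  exact ⟨⟨Q, P.mark - 1, by omega, by omega⟩, MarkedPPP.ext hQ (by simp only [thicken]; omega)⟩

theorem finite_markedSet (n m : ℕ) : (markedSet n m).Finite := by
  refine Set.Finite.of_finite_image (f := fun P : MarkedPPP => (P.toPPP, P.mark))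
    (((PPP.finite_pppSet n m).prod (Set.finite_Iic m)).subset ?_) ?_
  · rintro _ ⟨P, hP, rfl⟩
    exact ⟨hP, P.mark_le.trans (P.columnHeight_zero_le_area.trans hP.2.le)⟩
  · intro P _ Q _ h
    simp only [Prod.mk.injEq] at h
    exact MarkedPPP.ext h.1 h.2

end MarkedPPP

namespace Strip

/-! ### Strips -/

/-- The width of any PPP in the class. -/
def width (S : Strip) : ℕ :=
  Quotient.lift (fun P : PPP => P.width) (fun _ _ (h : PPP.IsRotation _ _) => h.1.symm) S

/-- Add a cell to every column of a strip. -/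
def thicken (S : Strip) : Strip :=
  Quotient.map (sa := PPP.rotationSetoid) (sb := PPP.rotationSetoid) PPP.thicken
    (fun _ _ h => PPP.isRotation_thicken.2 h) S

theorem thicken_injective : Function.Injective thicken := by
  intro S T
  refine Quotient.inductionOn₂ S T fun P Q h => ?_
  exact Quotient.sound (s := PPP.rotationSetoid) (PPP.isRotation_thicken.1 (Quotient.exact h))

theorem finite_stripSet (n m : ℕ) : (stripSet n m).Finite := by
  refine ((PPP.finite_pppSet n m).image (Quotient.mk PPP.rotationSetoid)).subset ?_
  intro S
  refine Quotient.inductionOn S fun P h => ?_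
  exact ⟨P, h, rfl⟩

end Strip

/-! ### Ultimate periods of the three generating functions -/

theorem isUltimatePeriod_seriesA (n : ℕ) : IsUltimatePeriod (seriesA n) (periodBound n) := by
  refine ⟨periodBound_pos n, n * (2 * n + 2), fun m hm => ?_⟩
  simp only [seriesA, PowerSeries.coeff_mk]
  exact ncard_add_eq_of_thickening PPP.semiPerimeter (fun P => P.area) (fun P => P.width)
    PPP.thicken PPP.thicken_injective PPP.semiPerimeter_thicken PPP.width_thicken
    PPP.area_thicken (fun P h => P.width_dvd_periodBound h)
    (fun P h ha => P.exists_thicken_eq h ha) hm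

theorem isUltimatePeriod_seriesB (n : ℕ) : IsUltimatePeriod (seriesB n) (periodBound n) := by
  refine ⟨periodBound_pos n, n * (2 * n + 2), fun m hm => ?_⟩
  simp only [seriesB, PowerSeries.coeff_mk]
  exact ncard_add_eq_of_thickening (fun P : MarkedPPP => P.semiPerimeter) (fun P => P.area)
    (fun P => P.width) MarkedPPP.thicken MarkedPPP.thicken_injective
    (fun P => P.toPPP.semiPerimeter_thicken) (fun P => P.toPPP.width_thicken)
    (fun P => P.toPPP.area_thicken) (fun P h => P.toPPP.width_dvd_periodBound h)
    (fun P h ha => P.exists_thicken_eq h ha) hm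

theorem isUltimatePeriod_seriesC (n : ℕ) : IsUltimatePeriod (seriesC n) (periodBound n) := by
  refine ⟨periodBound_pos n, n * (2 * n + 2), fun m hm => ?_⟩
  simp only [seriesC, PowerSeries.coeff_mk]
  refine ncard_add_eq_of_thickening Strip.semiPerimeter Strip.area Strip.width
    Strip.thicken Strip.thicken_injective ?_ ?_ ?_ ?_ ?_ hm
  · exact fun S => Quotient.inductionOn S PPP.semiPerimeter_thicken
  · exact fun S => Quotient.inductionOn S PPP.width_thicken
  · exact fun S => Quotient.inductionOn S PPP.area_thicken
  · exact fun S => Quotient.inductionOn S fun P h => P.width_dvd_periodBound h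
  · refine fun S => Quotient.inductionOn S fun P h ha => ?_
    obtain ⟨Q, rfl⟩ := P.exists_thicken_eq h ha
    exact ⟨Quotient.mk _ Q, rfl⟩

end PeriodicPolyomino

theorem mainTheorem3 (n : ℕ) :
    (∀ m : ℕ, (pppSet n m).Finite ∧ (markedSet n m).Finite ∧ (stripSet n m).Finite) ∧
    (∃ p : ℕ, IsPeriod (seriesA n) p ∧ p ∣ periodBound n) ∧
    (∃ p : ℕ, IsPeriod (seriesB n) p ∧ p ∣ periodBound n) ∧
    (∃ p : ℕ, IsPeriod (seriesC n) p ∧ p ∣ periodBound n) := by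
  refine ⟨fun m => ⟨PPP.finite_pppSet n m, MarkedPPP.finite_markedSet n m,
    Strip.finite_stripSet n m⟩, exists_isPeriod_dvd (isUltimatePeriod_seriesA n),
    exists_isPeriod_dvd (isUltimatePeriod_seriesB n),
    exists_isPeriod_dvd (isUltimatePeriod_seriesC n)⟩
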